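/- Let $n,m\in\mathbb N$. A weight on $\mathbb R^n$ is a nonnegative, locally integrable function. Cubes are cubes $Q\subset\mathbb R^n$ of positive finite side length with sides parallel to the coordinate axes, and $|Q|$ is the Lebesgue measure of $Q$. For $1<s<\infty$, a weight $w$ belongs to $RH_s$ if $$[w]_{RH_s}=\sup_Q\Big(\frac1{|Q|}\int_Q w^s\,dx\Big)^{1/s}\Big(\frac1{|Q|}\int_Q w\,dx\Big)^{-1}<\infty,$$ where the supremum is over all cubes $Q$ (a cube on which $w=0$ almost everywhere contributes $0$). **Theorem (multilinear reverse Hölder inequality).** Let $1<s_1,\dots,s_m<\infty$ with $\sum_{i=1}^m\frac1{s_i}=1$, and let $w_i\in RH_{s_i}$ for $i=1,\dots,m$. Then there is a constant $C<\infty$, independent of $Q$, such that for every cube $Q\subset\mathbb R^n$, $$\prod_{i=1}^m\Big(\frac1{|Q|}\int_Q w_i^{s_i}\,dx\Big)^{1/s_i}\le C\,\frac1{|Q|}\int_Q\prod_{i=1}^m w_i\,dx .$$ -/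

import Mathlib

open MeasureTheory
open scoped ENNReal NNReal

/-- The closed cube in `ℝⁿ` with lower corner `a`, side length `ℓ`, and sides parallel to the
coordinate axes. -/
def cube {n : ℕ} (a : Fin n → ℝ) (ℓ : ℝ) : Set (Fin n → ℝ) :=
  {x | ∀ j, a j ≤ x j ∧ x j ≤ a j + ℓ}

/-- A weight on `ℝⁿ`: a locally integrable function that is nonnegative almost everywhere. -/
structure IsWeight {n : ℕ} (w : (Fin n → ℝ) → ℝ) : Prop where
  locallyIntegrable : LocallyIntegrable w volume
  nonneg : ∀ᵐ x ∂(volume : Measure (Fin n → ℝ)), 0 ≤ w x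

/-- The reverse Hölder constant
`[w]_{RH_s} = sup_Q (avg_Q w ^ s) ^ (1 / s) * (avg_Q w)⁻¹`, with values in `[0, ∞]`; the supremum is
over all cubes with sides parallel to the axes. For a cube on which `w = 0` almost everywhere the
expression is `0 * ∞ = 0`. -/
noncomputable def rhConst {n : ℕ} (s : ℝ) (w : (Fin n → ℝ) → ℝ) : ℝ≥0∞ :=
  ⨆ (a : Fin n → ℝ) (ℓ : ℝ) (_ : 0 < ℓ),
    (⨍⁻ x in cube a ℓ, ENNReal.ofReal (w x) ^ s ∂volume) ^ (1 / s) *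
      (⨍⁻ x in cube a ℓ, ENNReal.ofReal (w x) ∂volume)⁻¹

/-- The reverse Hölder class `RH_s`. -/
structure MemRH {n : ℕ} (s : ℝ) (w : (Fin n → ℝ) → ℝ) : Prop where
  isWeight : IsWeight w
  rhConst_lt_top : rhConst s w < ∞

/-! ### Self-improvement of the `A_∞` condition on balls. -/

section AInfinity

open Metric Filter Topology Module

variable {E : Type*} [NormedAddCommGroup E] [NormedSpace ℝ E] [FiniteDimensional ℝ E]
  [MeasurableSpace E] [BorelSpace E] (μ : Measure E) [μ.IsAddHaarMeasure]

/-! Each weight is nearly as large as its `L^s` average on all but a small fraction of any cube.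
Granting this with exceptional fraction `1/(2m)` for each of the `m` weights, at least half of the
cube is good for all of them at once, and integrating the product over that half gives the
inequality.

To get the small exceptional sets, Hölder and the reverse Hölder bound first show that subsets of
almost full measure carry half of the mass of `w`. `exists_measure_closedBall_le_mul` upgrades this
to subsets of any fixed density `ε`, by repeatedly enlarging the subset through a Lebesgue density
and Vitali argument. A set of density `ε` on which `w` is tiny would then contradict the reverse
Hölder bound (`exists_measure_inter_lt_average_le`). Cubes are sup-norm balls, so the argument runs
on balls of a normed space. -/

theorem addHaar_closedBall_scale (x y : E) {t r : ℝ} (ht : 0 ≤ t) (hr : 0 ≤ r) :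
    μ (closedBall x (t * r)) = ENNReal.ofReal (t ^ finrank ℝ E) * μ (closedBall y r) := by
  rw [Measure.addHaar_closedBall_mul μ x ht hr, Measure.addHaar_closedBall_center μ y]

/-- Provides a shrinking ratio so close to 1 that one shrinking step cannot carry the density of a
set from below `γ₀` to above `γ`. -/
theorem exists_lt_mul_pow {a b : ℝ≥0∞} (hab : a < b) (hb : b ≠ ∞) (d : ℕ) :
    ∃ t : ℝ, 0 < t ∧ t < 1 ∧ a < b * ENNReal.ofReal (t ^ d) := by
  have hlim : Tendsto (fun t : ℝ => b * ENNReal.ofReal (t ^ d)) (𝓝[<] 1) (𝓝 b) := by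
    have h1 : Tendsto (fun t : ℝ => ENNReal.ofReal (t ^ d)) (𝓝[<] 1) (𝓝 1) := by
      have : Continuous fun t : ℝ => ENNReal.ofReal (t ^ d) :=
        ENNReal.continuous_ofReal.comp (continuous_pow d)
      simpa using (this.tendsto 1).mono_left nhdsWithin_le_nhds
    simpa using ENNReal.Tendsto.const_mul h1 (Or.inr hb)
  have h0 : ∀ᶠ t : ℝ in 𝓝[<] 1, 0 < t :=
    nhdsWithin_le_nhds (eventually_gt_nhds zero_lt_one)
  obtain ⟨t, h, h', h''⟩ :=
    ((hlim.eventually_const_lt hab).and (h0.and self_mem_nhdsWithin)).exists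
  exact ⟨t, h', h'', h⟩

/-- Almost every point of a set of small density in a ball lies in a smaller ball in which the
density of the set is intermediate. -/
theorem ae_exists_closedBall_density_mem_Icc {γ₀ γ : ℝ≥0∞} (h₀ : γ₀ < γ) (h₁ : γ < 1)
    {c : E} {r : ℝ} (hr : 0 < r) {F : Set E} (hFm : MeasurableSet F)
    (hF : F ⊆ closedBall c r) (hlt : μ F < γ * μ (closedBall c r)) :
    ∀ᵐ x ∂μ.restrict F, ∃ y : E, ∃ ρ : ℝ, 0 < ρ ∧ ρ ≤ r ∧ x ∈ closedBall y ρ ∧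
      closedBall y ρ ⊆ closedBall c r ∧ γ₀ * μ (closedBall y ρ) ≤ μ (F ∩ closedBall y ρ) ∧
      μ (F ∩ closedBall y ρ) ≤ γ * μ (closedBall y ρ) := by
  obtain ⟨t, ht0, ht1, ht⟩ := exists_lt_mul_pow h₀ (h₁.trans ENNReal.one_lt_top).ne (finrank ℝ E)
  have hpos : ∀ y : E, ∀ ρ : ℝ, 0 < ρ → μ (closedBall y ρ) ≠ 0 := fun y ρ h =>
    (measure_closedBall_pos μ y h).ne'
  have hfin : ∀ y : E, ∀ ρ : ℝ, μ (closedBall y ρ) ≠ ∞ := fun y ρ => measure_closedBall_lt_top.ne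
  filter_upwards [IsUnifLocDoublingMeasure.ae_tendsto_measure_inter_div μ F 1,
    ae_restrict_mem hFm] with x hx hxF
  have hxc : dist x c ≤ r := hF hxF
  -- Nested balls of radius `t ^ k * r` whose centres slide from `c` to `x`, all containing `x`. The
  -- density of `F` starts below `γ` and tends to 1; the ball just before it first exceeds `γ` is
  -- the one wanted.
  set y : ℕ → E := fun k => x + t ^ k • (c - x) with hy
  have hdist : ∀ k l, dist (y k) (y l) = |t ^ k - t ^ l| * dist x c := fun k l => by
    simp only [hy, dist_eq_norm, add_sub_add_left_eq_sub, ← sub_smul, norm_smul, Real.norm_eq_abs,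
      norm_sub_rev c x]
  have hmem : ∀ k, x ∈ closedBall (y k) (t ^ k * r) := fun k => by
    have : dist x (y k) = t ^ k * dist x c := by
      simp only [hy, dist_eq_norm, sub_add_cancel_left, norm_neg, norm_smul, Real.norm_eq_abs,
        abs_of_pos (pow_pos ht0 k), norm_sub_rev c x]
    rw [mem_closedBall, this]
    gcongr
  have hanti : ∀ k l, k ≤ l → closedBall (y l) (t ^ l * r) ⊆ closedBall (y k) (t ^ k * r) := by
    intro k l hkl
    apply closedBall_subset_closedBall'
    have hle : t ^ l ≤ t ^ k := pow_le_pow_of_le_one ht0.le ht1.le hkl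
    rw [hdist, abs_sub_comm, abs_of_nonneg (sub_nonneg.2 hle)]
    nlinarith [mul_le_mul_of_nonneg_left hxc (sub_nonneg.2 hle)]
  have hradius : Tendsto (fun k : ℕ => t ^ k * r) atTop (𝓝[>] 0) := by
    refine tendsto_nhdsWithin_iff.2 ⟨?_, Eventually.of_forall fun k => by
      simpa using mul_pos (pow_pos ht0 k) hr⟩
    simpa using (tendsto_pow_atTop_nhds_zero_of_lt_one ht0.le ht1).mul_const r
  have hlim := hx y (fun k => t ^ k * r) hradius (Eventually.of_forall fun k => by
    simpa using hmem k)
  have hex : ∃ k, γ * μ (closedBall (y k) (t ^ k * r)) < μ (F ∩ closedBall (y k) (t ^ k * r)) := by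
    obtain ⟨k, hk⟩ := (hlim.eventually_const_lt h₁).exists
    refine ⟨k, ?_⟩
    rwa [ENNReal.lt_div_iff_mul_lt (Or.inl (hpos _ _ (by positivity))) (Or.inl (hfin _ _))] at hk
  classical
  have hy0 : closedBall (y 0) (t ^ 0 * r) = closedBall c r := by simp [hy]
  obtain ⟨j, hj⟩ : ∃ j, Nat.find hex = j + 1 := by
    refine Nat.exists_eq_succ_of_ne_zero fun h => ?_
    have := Nat.find_spec hex
    rw [h, hy0, Set.inter_eq_left.2 hF] at this
    exact absurd this hlt.not_gt
  have hspec := Nat.find_spec hex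
  have hmin := Nat.find_min hex (m := j) (by omega)
  rw [hj] at hspec
  refine ⟨y j, t ^ j * r, by positivity, ?_, hmem j, hy0 ▸ hanti 0 j (zero_le), ?_, not_lt.1 hmin⟩
  · exact mul_le_of_le_one_left hr.le (pow_le_one₀ ht0.le ht1.le)
  · calc γ₀ * μ (closedBall (y j) (t ^ j * r))
        ≤ γ * ENNReal.ofReal (t ^ finrank ℝ E) * μ (closedBall (y j) (t ^ j * r)) := by gcongr
      _ = γ * μ (closedBall (y (j + 1)) (t ^ (j + 1) * r)) := by
        rw [pow_succ', mul_assoc t, addHaar_closedBall_scale μ _ (y j) ht0.le (by positivity),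
          mul_assoc]
      _ ≤ μ (F ∩ closedBall (y (j + 1)) (t ^ (j + 1) * r)) := hspec.le
      _ ≤ _ := measure_mono (Set.inter_subset_inter_right _ (hanti j (j + 1) (Nat.le_succ j)))

/-- If `ν` satisfies a weak comparability condition with respect to `μ`, then a set of small
`μ`-density in a ball can be enlarged by a fixed factor in `μ`-measure, at the price of a fixed
factor in `ν`-measure. -/
theorem exists_superset_measure_growth {ν : Measure E} {C : ℝ≥0∞} {γ₀ γ : ℝ≥0∞}
    (h₀ : γ₀ < γ) (h₁ : γ < 1)
    (hν : ∀ (y : E) (ρ : ℝ), 0 < ρ → ∀ G ⊆ closedBall y ρ, MeasurableSet G →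
      γ₀ * μ (closedBall y ρ) ≤ μ G → ν (closedBall y ρ) ≤ C * ν G)
    {c : E} {r : ℝ} (hr : 0 < r) {F : Set E} (hFm : MeasurableSet F)
    (hF : F ⊆ closedBall c r) (hlt : μ F < γ * μ (closedBall c r)) :
    ∃ F' ⊆ closedBall c r, MeasurableSet F' ∧
      (1 + (1 - γ) * (ENNReal.ofReal (4 ^ finrank ℝ E))⁻¹) * μ F ≤ μ F' ∧
      ν F' ≤ (1 + C) * ν F := by
  -- The lower density bound makes `hν` applicable to `F ∩ B`, controlling the `ν`-cost of adding
  -- `B`; the upper one leaves a fraction `1 - γ` of `B` outside `F` as the gain.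
  let t : Set (E × ℝ) := {p | 0 < p.2 ∧ p.2 ≤ r ∧ closedBall p.1 p.2 ⊆ closedBall c r ∧
      γ₀ * μ (closedBall p.1 p.2) ≤ μ (F ∩ closedBall p.1 p.2) ∧
      μ (F ∩ closedBall p.1 p.2) ≤ γ * μ (closedBall p.1 p.2)}
  obtain ⟨u, hut, hdisj, hcov⟩ := Vitali.exists_disjoint_subfamily_covering_enlargement_closedBall
    t Prod.fst Prod.snd r (fun p hp => hp.2.1) 4 (by norm_num)
  have hu : u.Countable := hdisj.countable_of_nonempty_interior fun p hp =>
    ⟨p.1, ball_subset_interior_closedBall (mem_ball_self (hut hp).1)⟩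
  have : Countable u := hu.to_subtype
  let B : E × ℝ → Set E := fun p => closedBall p.1 p.2
  have hBm : ∀ p, MeasurableSet (B p) := fun p => isClosed_closedBall.measurableSet
  have hBfin : ∀ p, μ (B p) ≠ ∞ := fun p => measure_closedBall_lt_top.ne
  have hd : Pairwise (Function.onFun Disjoint fun p : u => B p) := hdisj.subtype
  have hγ : γ ≠ ∞ := (h₁.trans ENNReal.one_lt_top).ne
  set κ : ℝ≥0∞ := ENNReal.ofReal (4 ^ finrank ℝ E) with hκ
  have hκ0 : κ ≠ 0 := by rw [hκ]; positivity
  have hκt : κ ≠ ∞ := ENNReal.ofReal_ne_top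
  have hcover : μ F ≤ κ * ∑' p : u, μ (B p) := by
    have hae : ∀ᵐ x ∂μ, x ∈ F → x ∈ ⋃ p : u, closedBall p.1.1 (4 * p.1.2) := by
      refine (ae_restrict_iff' hFm).1 ?_
      filter_upwards [ae_exists_closedBall_density_mem_Icc μ h₀ h₁ hr hFm hF hlt] with x hx
      obtain ⟨y, ρ, h1, h2, h3, h4, h5, h6⟩ := hx
      obtain ⟨b, hb, hsub⟩ := hcov (y, ρ) ⟨h1, h2, h4, h5, h6⟩
      exact Set.mem_iUnion.2 ⟨⟨b, hb⟩, hsub h3⟩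
    calc μ F ≤ μ (⋃ p : u, closedBall p.1.1 (4 * p.1.2)) := measure_mono_ae hae
      _ ≤ ∑' p : u, μ (closedBall p.1.1 (4 * p.1.2)) := measure_iUnion_le _
      _ = ∑' p : u, κ * μ (B p) := by
        congr 1; ext p
        exact addHaar_closedBall_scale μ _ _ (by norm_num) (hut p.2).1.le
      _ = _ := ENNReal.tsum_mul_left
  refine ⟨F ∪ ⋃ p : u, B p, Set.union_subset hF (Set.iUnion_subset fun p => (hut p.2).2.2.1),
    hFm.union (MeasurableSet.iUnion fun p => hBm p), ?_, ?_⟩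
  · have hdiff : ∀ p : u, (1 - γ) * μ (B p) ≤ μ (B p \ F) := fun p => by
      have h1 : μ (B p) ≤ γ * μ (B p) + μ (B p \ F) := by
        calc μ (B p) = μ (B p ∩ F) + μ (B p \ F) := (measure_inter_add_sdiff _ hFm).symm
          _ ≤ _ := by
            gcongr
            rw [Set.inter_comm]
            exact (hut p.2).2.2.2.2
      rw [ENNReal.sub_mul (fun _ _ => hBfin _), one_mul]
      exact tsub_le_iff_left.2 h1
    calc (1 + (1 - γ) * κ⁻¹) * μ F = μ F + (1 - γ) * (κ⁻¹ * μ F) := by ring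
      _ ≤ μ F + (1 - γ) * (κ⁻¹ * (κ * ∑' p : u, μ (B p))) := by gcongr
      _ = μ F + ∑' p : u, (1 - γ) * μ (B p) := by
        rw [← mul_assoc κ⁻¹, ENNReal.inv_mul_cancel hκ0 hκt, one_mul, ENNReal.tsum_mul_left]
      _ ≤ μ F + ∑' p : u, μ (B p \ F) := by gcongr with p; exact hdiff p
      _ = μ F + μ (⋃ p : u, B p \ F) := by
        rw [measure_iUnion (fun p q hpq => (hd hpq).mono Set.sdiff_subset Set.sdiff_subset)
          fun p => (hBm p).diff hFm]
      _ = μ (F ∪ ⋃ p : u, B p \ F) :=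
        (measure_union (Set.disjoint_iUnion_right.2 fun p => Set.disjoint_sdiff_right)
          (MeasurableSet.iUnion fun p : u => (hBm p).diff hFm)).symm
      _ ≤ μ (F ∪ ⋃ p : u, B p) := by
        gcongr
        exact Set.sdiff_subset
  · calc ν (F ∪ ⋃ p : u, B p) ≤ ν F + ∑' p : u, ν (B p) :=
        (measure_union_le _ _).trans (by gcongr; exact measure_iUnion_le _)
      _ ≤ ν F + ∑' p : u, C * ν (F ∩ B p) := by
        gcongr with p
        exact hν _ _ (hut p.2).1 _ Set.inter_subset_right (hFm.inter (hBm p)) (hut p.2).2.2.2.1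
      _ = ν F + C * ν (⋃ p : u, F ∩ B p) := by
        rw [ENNReal.tsum_mul_left, measure_iUnion (fun p q hpq =>
          (hd hpq).mono Set.inter_subset_right Set.inter_subset_right) fun p => hFm.inter (hBm p)]
      _ ≤ ν F + C * ν F := by
        gcongr
        exact Set.iUnion_subset fun p => Set.inter_subset_left
      _ = (1 + C) * ν F := by ring

/-- Self-improvement of the `A_∞` condition: comparability of `ν` and `μ` on subsets of almost full
measure of balls implies quantitative absolute continuity of `μ` with respect to `ν`. -/
theorem exists_measure_closedBall_le_mul {ν : Measure E} {C : ℝ≥0∞} (hC : C ≠ ∞) {γ₀ : ℝ≥0∞}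
    (h₀ : γ₀ < 1)
    (hν : ∀ (y : E) (ρ : ℝ), 0 < ρ → ∀ G ⊆ closedBall y ρ, MeasurableSet G →
      γ₀ * μ (closedBall y ρ) ≤ μ G → ν (closedBall y ρ) ≤ C * ν G)
    {ε : ℝ≥0∞} (hε : ε ≠ 0) :
    ∃ A : ℝ≥0∞, A ≠ ∞ ∧ ∀ (c : E) (r : ℝ), 0 < r → ∀ F ⊆ closedBall c r, MeasurableSet F →
      ε * μ (closedBall c r) ≤ μ F → ν (closedBall c r) ≤ A * ν F := by
  obtain ⟨γ, h₀γ, h₁⟩ := exists_between h₀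
  set θ : ℝ≥0∞ := 1 + (1 - γ) * (ENNReal.ofReal (4 ^ finrank ℝ E))⁻¹ with hθ
  have hθ1 : 1 < θ := by
    refine ENNReal.lt_add_right ENNReal.one_ne_top (mul_ne_zero (tsub_pos_of_lt h₁).ne' ?_)
    exact ENNReal.inv_ne_zero.2 ENNReal.ofReal_ne_top
  -- Here `k` bounds the number of enlargements, each gaining a factor `θ`, needed to reach density
  -- `γ`.
  have key : ∀ k : ℕ, ∀ (c : E) (r : ℝ), 0 < r → ∀ F ⊆ closedBall c r, MeasurableSet F →
      γ * μ (closedBall c r) ≤ θ ^ k * μ F → ν (closedBall c r) ≤ C * (1 + C) ^ k * ν F := by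
    intro k
    induction k with
    | zero =>
      intro c r hr F hF hFm h
      simp only [pow_zero, one_mul, mul_one] at h ⊢
      exact hν c r hr F hF hFm (le_trans (by gcongr) h)
    | succ k ih =>
      intro c r hr F hF hFm h
      rcases le_or_gt (γ * μ (closedBall c r)) (μ F) with hle | hlt
      · calc ν (closedBall c r) ≤ C * 1 * ν F := by
              rw [mul_one]
              exact hν c r hr F hF hFm (le_trans (by gcongr) hle)
          _ ≤ C * (1 + C) ^ (k + 1) * ν F := by
              gcongr
              exact one_le_pow₀ le_self_add
      · obtain ⟨F', hF', hFm', hμ, hνF⟩ :=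
          exists_superset_measure_growth μ h₀γ h₁ hν hr hFm hF hlt
        calc ν (closedBall c r) ≤ C * (1 + C) ^ k * ν F' := by
              refine ih c r hr F' hF' hFm' (h.trans ?_)
              rw [pow_succ, mul_assoc]
              gcongr
          _ ≤ C * (1 + C) ^ k * ((1 + C) * ν F) := by gcongr
          _ = C * (1 + C) ^ (k + 1) * ν F := by ring
  obtain ⟨k, hk⟩ : ∃ k : ℕ, ε⁻¹ < θ ^ k :=
    ((ENNReal.tendsto_pow_atTop_nhds_top_iff.2 hθ1).eventually_const_lt
      (ENNReal.inv_ne_top.2 hε).lt_top).exists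
  refine ⟨C * (1 + C) ^ k, by finiteness, fun c r hr F hF hFm h => key k c r hr F hF hFm ?_⟩
  calc γ * μ (closedBall c r) ≤ 1 * μ (closedBall c r) := by gcongr
    _ ≤ θ ^ k * ε * μ (closedBall c r) := by
      gcongr
      rw [← ENNReal.div_le_iff_le_mul (Or.inl hε) (Or.inr (one_pos.trans_le ?_).ne'), one_div]
      · exact hk.le
      · exact one_le_pow₀ hθ1.le
    _ ≤ θ ^ k * μ F := by rw [mul_assoc]; gcongr

end AInfinity

theorem ENNReal.le_two_mul_of_le_half_add {x y z : ℝ≥0∞} (hx : x ≠ ∞) (h : x ≤ y + z)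
    (hy : y ≤ 2⁻¹ * x) : x ≤ 2 * z := by
  have h1 : 2⁻¹ * x + 2⁻¹ * x ≤ 2⁻¹ * x + z := by
    rw [← add_mul, ENNReal.inv_two_add_inv_two, one_mul]
    exact h.trans (by gcongr)
  have h2 : 2⁻¹ * x ≤ z :=
    (ENNReal.add_le_add_iff_left (ENNReal.mul_ne_top (by simp) hx)).1 h1
  calc x = 2 * (2⁻¹ * x) := by
        rw [← mul_assoc, ENNReal.mul_inv_cancel two_ne_zero ENNReal.ofNat_ne_top, one_mul]
    _ ≤ 2 * z := by gcongr

/-! ### From reverse Hölder to pointwise lower bounds and products. -/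

section ReverseHolder

open Metric Filter Topology

/-- A function satisfying a reverse Hölder inequality on a set puts at least half of its mass on
every subset of almost full measure. -/
theorem exists_setLIntegral_le_two_mul_of_reverseHolder {s : ℝ} (hs : 1 < s) {K : ℝ≥0∞}
    (hK : K ≠ ∞) :
    ∃ γ : ℝ≥0∞, γ < 1 ∧ ∀ {α : Type*} [MeasurableSpace α] {μ : Measure α} {g : α → ℝ≥0∞},
      Measurable g → ∀ {B : Set α}, MeasurableSet B → μ B ≠ ∞ → ∫⁻ x in B, g x ∂μ ≠ ∞ →
      (⨍⁻ x in B, g x ^ s ∂μ) ^ (1 / s) ≤ K * ⨍⁻ x in B, g x ∂μ →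
      ∀ G ⊆ B, MeasurableSet G → γ * μ B ≤ μ G →
        ∫⁻ x in B, g x ∂μ ≤ 2 * ∫⁻ x in G, g x ∂μ := by
  have hs0 : 0 < s := one_pos.trans hs
  set q := s.conjExponent
  have hq : s.HolderConjugate q := Real.HolderConjugate.conjExponent hs
  have hq0 : 0 < 1 / q := one_div_pos.2 hq.symm.pos
  -- Hölder on `B \ G`, of density at most `t`, bounds its share of the mass by `K * t ^ (1 / q)`.
  obtain ⟨t, ht, ht0, ht1⟩ : ∃ t : ℝ≥0∞, K * t ^ (1 / q) < 2⁻¹ ∧ 0 < t ∧ t < 1 := by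
    have hlim : Tendsto (fun t : ℝ≥0∞ => K * t ^ (1 / q)) (𝓝[>] 0) (𝓝 0) := by
      have h1 : Tendsto (fun t : ℝ≥0∞ => t ^ (1 / q)) (𝓝[>] 0) (𝓝 0) := by
        have := (ENNReal.continuous_rpow_const (y := 1 / q)).tendsto 0
        rw [ENNReal.zero_rpow_of_pos hq0] at this
        exact this.mono_left nhdsWithin_le_nhds
      simpa using ENNReal.Tendsto.const_mul h1 (Or.inr hK)
    have hlt : ∀ᶠ t : ℝ≥0∞ in 𝓝[>] 0, t < 1 :=
      nhdsWithin_le_nhds (eventually_lt_nhds one_pos)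
    exact ((hlim.eventually_lt_const (by simp)).and
      ((eventually_mem_nhdsWithin).and hlt)).exists
  refine ⟨1 - t, ENNReal.sub_lt_self ENNReal.one_ne_top one_ne_zero ht0.ne', ?_⟩
  intro α _ μ g hg B hB hBfin hint hRH G hGB hG hγ
  have hdiff : μ (B \ G) ≤ t * μ B := by
    rw [measure_sdiff hGB hG.nullMeasurableSet (ne_top_of_le_ne_top hBfin (measure_mono hGB))]
    rw [tsub_le_iff_left]
    calc μ B = (1 - t + t) * μ B := by rw [tsub_add_cancel_of_le ht1.le, one_mul]
      _ ≤ μ G + t * μ B := by rw [add_mul]; gcongr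
  refine ENNReal.le_two_mul_of_le_half_add hint (y := ∫⁻ x in B \ G, g x ∂μ) ?_ ?_
  · rw [add_comm, ← lintegral_inter_add_sdiff g B hG, Set.inter_eq_right.2 hGB]
  calc ∫⁻ x in B \ G, g x ∂μ
      ≤ (∫⁻ x in B \ G, g x ^ s ∂μ) ^ (1 / s) * (μ (B \ G)) ^ (1 / q) := by
        simpa using ENNReal.lintegral_mul_le_Lp_mul_Lq (μ.restrict (B \ G)) hq hg.aemeasurable
          (aemeasurable_const (b := (1 : ℝ≥0∞)))
    _ ≤ (∫⁻ x in B, g x ^ s ∂μ) ^ (1 / s) * (t * μ B) ^ (1 / q) := by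
        gcongr
        exact Set.sdiff_subset
    _ = (⨍⁻ x in B, g x ^ s ∂μ) ^ (1 / s) * t ^ (1 / q) *
          ((μ B) ^ (1 / s) * (μ B) ^ (1 / q)) := by
        rw [← measure_mul_setLAverage _ hBfin, ENNReal.mul_rpow_of_nonneg _ _ (by positivity),
          ENNReal.mul_rpow_of_nonneg _ _ hq0.le]
        ring
    _ = (⨍⁻ x in B, g x ^ s ∂μ) ^ (1 / s) * t ^ (1 / q) * μ B := by
        rw [← ENNReal.rpow_add_of_nonneg _ _ (by positivity) hq0.le, one_div, one_div,
          hq.inv_add_inv_eq_one, ENNReal.rpow_one]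
    _ ≤ K * (⨍⁻ x in B, g x ∂μ) * t ^ (1 / q) * μ B := by gcongr
    _ = K * t ^ (1 / q) * (μ B * ⨍⁻ x in B, g x ∂μ) := by ring
    _ ≤ 2⁻¹ * ∫⁻ x in B, g x ∂μ := by
        rw [measure_mul_setLAverage _ hBfin]
        gcongr

variable {E : Type*} [NormedAddCommGroup E] [NormedSpace ℝ E] [FiniteDimensional ℝ E]
  [MeasurableSpace E] [BorelSpace E] (μ : Measure E) [μ.IsAddHaarMeasure]

/-- A function in a reverse Hölder class is bounded below by a multiple of its `L^s` average outside
a subset of small density of each ball. -/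
theorem exists_measure_inter_lt_average_le {s : ℝ} (hs : 1 < s) {K : ℝ≥0∞} (hK : K ≠ ∞)
    {g : E → ℝ≥0∞} (hg : Measurable g)
    (hint : ∀ (c : E) (r : ℝ), ∫⁻ x in closedBall c r, g x ∂μ ≠ ∞)
    (hRH : ∀ (c : E) (r : ℝ), 0 < r → (⨍⁻ x in closedBall c r, g x ^ s ∂μ) ^ (1 / s) ≤
      K * ⨍⁻ x in closedBall c r, g x ∂μ)
    {ε : ℝ≥0∞} (hε : ε ≠ 0) :
    ∃ D : ℝ≥0∞, D ≠ ∞ ∧ ∀ (c : E) (r : ℝ), 0 < r →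
      μ (closedBall c r ∩ {x | D * g x < (⨍⁻ y in closedBall c r, g y ^ s ∂μ) ^ (1 / s)}) ≤
        ε * μ (closedBall c r) := by
  have hBm : ∀ (c : E) (r : ℝ), MeasurableSet (closedBall c r) := fun c r =>
    isClosed_closedBall.measurableSet
  have hBfin : ∀ (c : E) (r : ℝ), μ (closedBall c r) ≠ ∞ := fun c r =>
    measure_closedBall_lt_top.ne
  obtain ⟨γ, hγ, hhalf⟩ := exists_setLIntegral_le_two_mul_of_reverseHolder hs hK
  obtain ⟨A, hA, hmain⟩ := exists_measure_closedBall_le_mul μ (ν := μ.withDensity g) (C := 2)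
    ENNReal.ofNat_ne_top hγ (fun y ρ hρ G hG hGm h => by
      rw [withDensity_apply _ (hBm y ρ), withDensity_apply _ hGm]
      exact hhalf hg (hBm y ρ) (hBfin y ρ) (hint y ρ) (hRH y ρ hρ) G hG hGm h) hε
  -- If `F` had density above `ε`, its mass would be at least `1/A` of the total, while smallness of
  -- `g` on `F` gives `(K * A + 1) ∫_F g ≤ K * A ∫_F g`. The extra 1 forces this mass to vanish;
  -- then `L = 0`, and the strict inequality makes `F` empty.
  refine ⟨K * A + 1, by finiteness, fun c r hr => ?_⟩
  set L := (⨍⁻ y in closedBall c r, g y ^ s ∂μ) ^ (1 / s) with hL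
  set F := closedBall c r ∩ {x | (K * A + 1) * g x < L} with hF
  have hFm : MeasurableSet F := (hBm c r).inter (measurableSet_lt (hg.const_mul _) measurable_const)
  by_contra! hlt
  have hνF := hmain c r hr F Set.inter_subset_left hFm hlt.le
  rw [withDensity_apply _ (hBm c r), withDensity_apply _ hFm] at hνF
  have hFfin : ∫⁻ x in F, g x ∂μ ≠ ∞ :=
    ne_top_of_le_ne_top (hint c r) (lintegral_mono_set Set.inter_subset_left)
  have hup : (K * A + 1) * ∫⁻ x in F, g x ∂μ ≤ K * A * ∫⁻ x in F, g x ∂μ := by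
    calc (K * A + 1) * ∫⁻ x in F, g x ∂μ = ∫⁻ x in F, (K * A + 1) * g x ∂μ :=
          (lintegral_const_mul _ hg).symm
      _ ≤ ∫⁻ _ in F, L ∂μ := setLIntegral_mono' hFm fun x hx => (le_of_lt hx.2)
      _ = L * μ F := setLIntegral_const _ _
      _ ≤ (K * ⨍⁻ x in closedBall c r, g x ∂μ) * μ (closedBall c r) := by
          gcongr
          · exact hRH c r hr
          · exact Set.inter_subset_left
      _ = K * ∫⁻ x in closedBall c r, g x ∂μ := by
          rw [mul_assoc, mul_comm _ (μ _), measure_mul_setLAverage _ (hBfin c r)]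
      _ ≤ K * (A * ∫⁻ x in F, g x ∂μ) := by gcongr
      _ = _ := by ring
  have hF0 : ∫⁻ x in F, g x ∂μ = 0 := by
    have h : K * A * ∫⁻ x in F, g x ∂μ + ∫⁻ x in F, g x ∂μ ≤ K * A * ∫⁻ x in F, g x ∂μ + 0 := by
      rw [add_zero]
      calc _ = (K * A + 1) * ∫⁻ x in F, g x ∂μ := by ring
        _ ≤ _ := hup
    exact nonpos_iff_eq_zero.1 ((ENNReal.add_le_add_iff_left (by finiteness)).1 h)
  have hB0 : ⨍⁻ x in closedBall c r, g x ∂μ = 0 := by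
    rw [hF0, mul_zero, nonpos_iff_eq_zero] at hνF
    rw [setLAverage_eq, hνF, ENNReal.zero_div]
  have hL0 : L = 0 := by
    have := hRH c r hr
    rwa [hB0, mul_zero, nonpos_iff_eq_zero] at this
  have : F = ∅ := by simp [hF, hL0]
  simp [this] at hlt

theorem exists_prod_average_le_mul_average_prod {ι : Type*} [Fintype ι] {s : ι → ℝ}
    (hs : ∀ i, 1 < s i) {K : ι → ℝ≥0∞} (hK : ∀ i, K i ≠ ∞) {g : ι → E → ℝ≥0∞}
    (hg : ∀ i, Measurable (g i))
    (hint : ∀ i (c : E) (r : ℝ), ∫⁻ x in closedBall c r, g i x ∂μ ≠ ∞)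
    (hRH : ∀ i (c : E) (r : ℝ), 0 < r → (⨍⁻ x in closedBall c r, g i x ^ s i ∂μ) ^ (1 / s i) ≤
      K i * ⨍⁻ x in closedBall c r, g i x ∂μ) :
    ∃ C : ℝ≥0∞, C ≠ ∞ ∧ ∀ (c : E) (r : ℝ), 0 < r →
      ∏ i, (⨍⁻ x in closedBall c r, g i x ^ s i ∂μ) ^ (1 / s i) ≤
        C * ⨍⁻ x in closedBall c r, ∏ i, g i x ∂μ := by
  have hε : (2 * (Fintype.card ι : ℝ≥0∞))⁻¹ ≠ 0 := by
    rw [ENNReal.inv_ne_zero]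
    finiteness
  choose D hD hsmall using fun i =>
    exists_measure_inter_lt_average_le μ (hs i) (hK i) (hg i) (hint i) (hRH i) hε
  refine ⟨2 * ∏ i, D i, ENNReal.mul_ne_top (by simp) (ENNReal.prod_ne_top fun i _ => hD i),
    fun c r hr => ?_⟩
  set B := closedBall c r
  have hBfin : μ B ≠ ∞ := measure_closedBall_lt_top.ne
  have hB0 : μ B ≠ 0 := (measure_closedBall_pos μ c hr).ne'
  set L : ι → ℝ≥0∞ := fun i => (⨍⁻ x in B, g i x ^ s i ∂μ) ^ (1 / s i) with hL
  set G : Set E := B ∩ {x | ∀ i, L i ≤ D i * g i x} with hG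
  have hGm : MeasurableSet G := isClosed_closedBall.measurableSet.inter <| by
    rw [Set.ofPred_forall]
    exact MeasurableSet.iInter fun i => measurableSet_le measurable_const ((hg i).const_mul _)
  have hGlarge : μ B ≤ 2 * μ G := by
    refine ENNReal.le_two_mul_of_le_half_add hBfin
      (y := ∑ i, μ (B ∩ {x | D i * g i x < L i})) ?_ ?_
    · calc μ B ≤ μ ((⋃ i, B ∩ {x | D i * g i x < L i}) ∪ G) := by
            refine measure_mono fun x hx => ?_
            by_cases h : ∀ i, L i ≤ D i * g i x
            · exact Or.inr ⟨hx, h⟩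
            · push Not at h
              obtain ⟨i, hi⟩ := h
              exact Or.inl (Set.mem_iUnion.2 ⟨i, hx, hi⟩)
        _ ≤ _ := (measure_union_le _ _).trans (by gcongr; exact measure_iUnion_fintype_le _ _)
    · calc ∑ i, μ (B ∩ {x | D i * g i x < L i})
          ≤ ∑ _i : ι, (2 * (Fintype.card ι : ℝ≥0∞))⁻¹ * μ B :=
            Finset.sum_le_sum fun i _ => hsmall i c r hr
        _ = 2⁻¹ * ((Fintype.card ι : ℝ≥0∞) / Fintype.card ι) * μ B := by
            rw [Finset.sum_const, Finset.card_univ, nsmul_eq_mul,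
              ENNReal.mul_inv (Or.inl two_ne_zero) (Or.inl ENNReal.ofNat_ne_top), div_eq_mul_inv]
            ring
        -- Only an inequality, since `0 / 0 = 0` when `ι` is empty.
        _ ≤ 2⁻¹ * 1 * μ B := by
            gcongr
            exact ENNReal.div_self_le_one
        _ = 2⁻¹ * μ B := by rw [mul_one]
  rw [setLAverage_eq, ← mul_div_assoc, ENNReal.le_div_iff_mul_le (Or.inl hB0) (Or.inl hBfin)]
  calc (∏ i, L i) * μ B ≤ (∏ i, L i) * (2 * μ G) := by gcongr
    _ = 2 * ∫⁻ _ in G, ∏ i, L i ∂μ := by rw [setLIntegral_const]; ring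
    _ ≤ 2 * ∫⁻ x in G, ∏ i, D i * g i x ∂μ := by
        gcongr 2 * ?_
        exact setLIntegral_mono' hGm fun x hx => Finset.prod_le_prod' fun i _ => hx.2 i
    _ = 2 * ((∏ i, D i) * ∫⁻ x in G, ∏ i, g i x ∂μ) := by
        simp_rw [Finset.prod_mul_distrib]
        rw [lintegral_const_mul _ (Finset.measurable_prod _ fun i _ => hg i)]
    _ ≤ 2 * ((∏ i, D i) * ∫⁻ x in B, ∏ i, g i x ∂μ) := by
        gcongr
        exact Set.inter_subset_left
    _ = _ := by ring

end ReverseHolder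

/-! ### Transfer to cubes and weights. -/

theorem cube_eq_closedBall {n : ℕ} (a : Fin n → ℝ) {ℓ : ℝ} (hℓ : 0 ≤ ℓ) :
    cube a ℓ = Metric.closedBall (fun j => a j + ℓ / 2) (ℓ / 2) := by
  ext x
  rw [Metric.mem_closedBall, dist_pi_le_iff (by positivity)]
  refine forall_congr' fun j => ?_
  rw [Real.dist_eq, abs_le]
  constructor <;> rintro ⟨h1, h2⟩ <;> constructor <;> linarith

theorem closedBall_eq_cube {n : ℕ} (c : Fin n → ℝ) {r : ℝ} (hr : 0 ≤ r) :
    Metric.closedBall c r = cube (fun j => c j - r) (2 * r) := by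
  rw [cube_eq_closedBall _ (by positivity)]
  congr 1
  · ext j; ring
  · ring

theorem IsWeight.setLIntegral_closedBall_ne_top {n : ℕ} {w : (Fin n → ℝ) → ℝ} (hw : IsWeight w)
    (c : Fin n → ℝ) (r : ℝ) : ∫⁻ x in Metric.closedBall c r, ENNReal.ofReal (w x) ≠ ∞ :=
  (hw.locallyIntegrable.integrableOn_isCompact
    (isCompact_closedBall c r)).lintegral_lt_top.ne

theorem MemRH.reverseHolder_closedBall {n : ℕ} {s : ℝ} (hs : 1 < s) {w : (Fin n → ℝ) → ℝ}
    (hw : MemRH s w) (c : Fin n → ℝ) {r : ℝ} (hr : 0 < r) :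
    (⨍⁻ x in Metric.closedBall c r, ENNReal.ofReal (w x) ^ s ∂volume) ^ (1 / s) ≤
      rhConst s w * ⨍⁻ x in Metric.closedBall c r, ENNReal.ofReal (w x) ∂volume := by
  have hs0 : 0 < s := one_pos.trans hs
  have hfin := hw.isWeight.setLIntegral_closedBall_ne_top c r
  have hsup : (⨍⁻ x in Metric.closedBall c r, ENNReal.ofReal (w x) ^ s ∂volume) ^ (1 / s) *
      (⨍⁻ x in Metric.closedBall c r, ENNReal.ofReal (w x) ∂volume)⁻¹ ≤ rhConst s w := by
    rw [closedBall_eq_cube c hr.le]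
    exact le_iSup₂_of_le (fun j => c j - r) (2 * r) (le_iSup_of_le (by positivity) le_rfl)
  -- With zero average the bound on the quotient says nothing, as `0 * ∞ = 0`; but then `w` vanishes
  -- almost everywhere on the ball.
  by_cases h0 : ⨍⁻ x in Metric.closedBall c r, ENNReal.ofReal (w x) ∂volume = 0
  · have hae : ∀ᵐ x ∂volume.restrict (Metric.closedBall c r), ENNReal.ofReal (w x) = 0 := by
      rw [setLAverage_eq, ENNReal.div_eq_zero_iff] at h0
      rcases h0 with h0 | h0
      · exact (lintegral_eq_zero_iff'
          hw.isWeight.locallyIntegrable.aestronglyMeasurable.aemeasurable.ennreal_ofReal.restrict).1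
          h0
      · exact absurd h0 measure_closedBall_lt_top.ne
    have hzero : ⨍⁻ x in Metric.closedBall c r, ENNReal.ofReal (w x) ^ s ∂volume = 0 := by
      rw [laverage_congr (g := fun _ => 0), laverage_zero]
      filter_upwards [hae] with x hx
      rw [hx, ENNReal.zero_rpow_of_pos hs0]
    rw [hzero, ENNReal.zero_rpow_of_pos (by positivity)]
    exact zero_le
  · rwa [← div_eq_mul_inv,
      ENNReal.div_le_iff_le_mul (Or.inl h0) (Or.inl (setLAverage_lt_top hfin).ne)] at hsup

theorem mainTheorem1 {n m : ℕ} (s : Fin m → ℝ) (hs : ∀ i, 1 < s i)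
    (hsum : ∑ i, 1 / s i = 1)
    (w : Fin m → (Fin n → ℝ) → ℝ) (hw : ∀ i, MemRH (s i) (w i)) :
    ∃ C : ℝ≥0, ∀ (a : Fin n → ℝ) (ℓ : ℝ), 0 < ℓ →
      ∏ i, (⨍⁻ x in cube a ℓ, ENNReal.ofReal (w i x) ^ s i ∂volume) ^ (1 / s i) ≤
        C * ⨍⁻ x in cube a ℓ, ∏ i, ENNReal.ofReal (w i x) ∂volume := by
  have hmeas : ∀ i, AEMeasurable (fun x => ENNReal.ofReal (w i x)) volume := fun i =>
    (hw i).isWeight.locallyIntegrable.aestronglyMeasurable.aemeasurable.ennreal_ofReal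
  -- Measurable representatives make the level sets measurable; all averages are unchanged.
  set g : Fin m → (Fin n → ℝ) → ℝ≥0∞ := fun i => (hmeas i).mk
  have hgw : ∀ i, ∀ᵐ x, g i x = ENNReal.ofReal (w i x) := fun i => (hmeas i).ae_eq_mk.symm
  have hint : ∀ i c r, ∫⁻ x in Metric.closedBall c r, g i x =
      ∫⁻ x in Metric.closedBall c r, ENNReal.ofReal (w i x) := fun i c r =>
    lintegral_congr_ae (ae_restrict_of_ae (hgw i))
  have havg : ∀ i c r, ⨍⁻ x in Metric.closedBall c r, g i x ∂volume =
      ⨍⁻ x in Metric.closedBall c r, ENNReal.ofReal (w i x) ∂volume := fun i c r =>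
    laverage_congr (ae_restrict_of_ae (hgw i))
  have havgs : ∀ i c r, ⨍⁻ x in Metric.closedBall c r, g i x ^ s i ∂volume =
      ⨍⁻ x in Metric.closedBall c r, ENNReal.ofReal (w i x) ^ s i ∂volume := fun i c r =>
    laverage_congr (ae_restrict_of_ae ((hgw i).mono fun x hx => by simp only [hx]))
  have hprod : ∀ c r, ⨍⁻ x in Metric.closedBall c r, ∏ i, g i x ∂volume =
      ⨍⁻ x in Metric.closedBall c r, ∏ i, ENNReal.ofReal (w i x) ∂volume := fun c r =>
    laverage_congr (ae_restrict_of_ae ((ae_all_iff.2 hgw).mono fun x hx => by simp only [hx]))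
  obtain ⟨C, hC, h⟩ := exists_prod_average_le_mul_average_prod
    (volume : Measure (Fin n → ℝ)) (g := g) hs (fun i => (hw i).rhConst_lt_top.ne)
    (fun i => (hmeas i).measurable_mk)
    (fun i c r => (hint i c r).trans_ne ((hw i).isWeight.setLIntegral_closedBall_ne_top c r))
    (fun i c r hr => by
      rw [havgs, havg]
      exact (hw i).reverseHolder_closedBall (hs i) c hr)
  refine ⟨C.toNNReal, fun a ℓ hℓ => ?_⟩
  have := h (fun j => a j + ℓ / 2) (ℓ / 2) (by positivity)
  rw [hprod] at this
  simp_rw [havgs] at this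
  rwa [ENNReal.coe_toNNReal hC, cube_eq_closedBall a hℓ.le]
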